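/- **Setting.** For $n\ge 2$ and $0<\epsilon\le \frac1{n-1}$, the instance $\mathcal I(n,\epsilon)$ consists of $n$ urns; urn $i$ contains a fraction $p_i=\frac{1-\epsilon(n-1)}2+(i-1)\epsilon$ of blue balls and a fraction $1-p_i$ of red balls, $i=1,\dots,n$. One urn is the (unknown) correct urn. Each of $m$ voters independently draws, with replacement, one ball from the correct urn and casts one vote for an urn. A (possibly asymmetric) voting scheme for $m$ voters consists of probability distributions $(R_{1,t},\dots,R_{n,t})$ and $(B_{1,t},\dots,B_{n,t})$ for each voter $t$: if she draws a red (respectively blue) ball, voter $t$ votes for urn $i$ with probability $R_{i,t}$ (respectively $B_{i,t}$), independently of the other voters. The correct urn wins the election if it receives strictly more votes than every other urn; otherwise the voters fail. **Theorem.** There exist absolute constants $H,c,\kappa>0$ such that the following holds for every $\eta\in(0,H)$, every integer $n\ge120$ and every real $\epsilon$ with $0<\epsilon\le\frac1{11(n-1)}$. For every $m\le c\,n^3\epsilon^{-2}\ln\frac1\eta$ and every voting scheme for $\mathcal I(n,\epsilon)$ with $m$ voters there is an urn $i\in\{1,\dots,n\}$ such that, when $i$ is the correct urn, the voters fail with probability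 at least $\kappa\,\eta$. -/

import Mathlib

open MeasureTheory

noncomputable section

/-- The fraction of blue balls in an urn of the evenly spaced instance `I(n, ε)`. The urns are
indexed by `Fin n`, so that `i = 0, …, n - 1` here is urn number `i + 1`. -/
def blueFraction (n : ℕ) (ε : ℝ) (i : Fin n) : ℝ :=
  (1 - ε * ((n : ℝ) - 1)) / 2 + ((i : ℕ) : ℝ) * ε

/-- A (possibly asymmetric) voting scheme for `m` voters and `n` urns: each voter has her own
randomized rule, made of one distribution over the urns for each colour that she may draw. -/
structure VotingScheme (m n : ℕ) where
  /-- The distribution of the vote of voter `t` if she draws a red ball. -/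
  red : Fin m → PMF (Fin n)
  /-- The distribution of the vote of voter `t` if she draws a blue ball. -/
  blue : Fin m → PMF (Fin n)

/-- The distribution of the vote of voter `t` when the unknown urn has a fraction `p` of blue
balls: she draws a blue ball with probability `p` and a red one with probability `1 - p`. -/
def VotingScheme.voteLaw {m n : ℕ} (S : VotingScheme m n) (p : ℝ) (t : Fin m) :
    Measure (Fin n) :=
  ENNReal.ofReal p • (S.blue t).toMeasure + ENNReal.ofReal (1 - p) • (S.red t).toMeasure

/-- The joint distribution of the `m` votes: the draws (with replacement) and the randomized rules
of different voters are independent. -/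
def VotingScheme.ballotLaw {m n : ℕ} (S : VotingScheme m n) (p : ℝ) :
    Measure (Fin m → Fin n) :=
  Measure.pi fun t => S.voteLaw p t

/-- The number of votes that urn `j` receives. -/
def voteCount {m n : ℕ} (v : Fin m → Fin n) (j : Fin n) : ℕ :=
  (Finset.univ.filter fun t => v t = j).card

/-- Urn `i` wins the plurality election: it gets strictly more votes than every other urn. -/
def WinsPlurality {m n : ℕ} (v : Fin m → Fin n) (i : Fin n) : Prop :=
  ∀ j, j ≠ i → voteCount v j < voteCount v i

/-- The probability that the voters fail on the instance `I(n, ε)` when the unknown urn is `i`,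
that is, that urn `i` does not win. -/
def VotingScheme.failProb {m n : ℕ} (S : VotingScheme m n) (ε : ℝ) (i : Fin n) : ℝ :=
  (S.ballotLaw (blueFraction n ε i)).real {v | ¬ WinsPlurality v i}

end

/-!
The expected number of votes `V_i(p)` of urn `i` is an affine function of the blue fraction `p`.
If urn `i` wins at its own blue fraction for every `i`, then the lines `V_i` form an upper envelope
in this order, so their slopes `b_i` increase with `i`; the point is to quantify by how much.

Let `d_i` be the sum over the voters of the absolute difference that the colour makes to the
probability of a vote for `i`. Then `|b_i| ≤ d_i`, the `d_i` add up to at most `2 m`, and for every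
`p` in `[5/11, 6/11]` the lead of `i` over `j` has a variance of at least a constant times
`d_i + d_j` (`VotingScheme.le_variance_pairLead`). Working with `d_i` instead of the expected number
of votes is what makes the argument cover asymmetric schemes, in which some votes may be certain.

A sum of independent variables in `{-1, 0, 1}` whose mean is at most `√T` standard deviations, and at
most a small multiple of the variance, is nonpositive with probability at least a constant times
`exp (-64 T)` (`exp_le_measureReal_sum_nonpos`). With `T` proportional to `ln (1 / η)`, an urn can
therefore fail with probability less than `κ η` only if its expected lead over each neighbour
exceeds `√(T (d_i + d_j))` up to a constant. Since the leads of `i` over `i + 1` at `p_i` and of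
`i + 1` over `i` at `p_{i + 1} = p_i + ε` sum to `ε (b_{i + 1} - b_i)`, consecutive slopes differ by at
least a constant times `ε⁻¹ √(T (|b_i| + |b_{i + 1}|))` (`VotingScheme.slope_increment`). Hence the
signed square roots of the slopes are separated by a constant times `√T / ε`, and the sum of their
squares, which is at most `2 m`, is of order at least `n ^ 3 T / ε ^ 2`
(`VotingScheme.card_voters_ge`).
-/

open ProbabilityTheory

/-! ### Lower tail of a sum of independent bounded integer variables -/

lemma one_add_add_sq_le_exp {x : ℝ} (hx : |x| ≤ 1 / 5) : 1 + x + 9 / 20 * x ^ 2 ≤ Real.exp x := by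
  have h := Real.exp_bound (x := x) (n := 3) (by linarith) (by norm_num)
  have h2 := (abs_le.1 h).1
  have h3 : |x| ^ 3 ≤ 1 / 5 * x ^ 2 := by
    rw [pow_succ, sq_abs]; nlinarith [sq_nonneg x]
  norm_num [Finset.sum_range_succ, Nat.factorial] at h2
  nlinarith [sq_nonneg x]

lemma exp_le_one_add_add_sq {x : ℝ} (hx : |x| ≤ 1) : Real.exp x ≤ 1 + x + x ^ 2 := by
  have h := (abs_le.1 (Real.abs_exp_sub_one_sub_id_le hx)).2
  linarith

section OneVariable

variable {Ω : Type*} [MeasurableSpace Ω] (ν : Measure Ω) [IsProbabilityMeasure ν] {x : Ω → ℝ}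

lemma abs_sub_integral_le_two (hx : ∀ ω, |x ω| ≤ 1) (ω : Ω) : |x ω - ∫ a, x a ∂ν| ≤ 2 := by
  have h1 : |∫ a, x a ∂ν| ≤ 1 := by
    have := norm_integral_le_of_norm_le_const (μ := ν) (f := x) (C := 1)
      (by simpa using .of_forall hx)
    simpa using this
  calc _ ≤ |x ω| + |∫ a, x a ∂ν| := abs_sub _ _
    _ ≤ 2 := by linarith [hx ω]

variable [Finite Ω] [MeasurableSingletonClass Ω]

lemma integral_quadratic_centered (l c : ℝ) :
    ∫ ω, (1 + -l * (x ω - ∫ a, x a ∂ν) + c * (-l * (x ω - ∫ a, x a ∂ν)) ^ 2) ∂ν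
      = 1 + c * (l ^ 2 * Var[x; ν]) := by
  have hv : Var[x; ν] = ∫ ω, (x ω - ∫ a, x a ∂ν) ^ 2 ∂ν :=
    variance_eq_integral (Measurable.of_discrete.aemeasurable)
  have h0 : ∫ ω, (x ω - ∫ a, x a ∂ν) ∂ν = 0 := by
    rw [integral_sub .of_finite .of_finite]; simp
  simp only [mul_pow]
  rw [integral_add .of_finite .of_finite, integral_add .of_finite .of_finite]
  simp only [integral_const_mul, h0, ← hv]
  simp

lemma integral_exp_centered_le (hx : ∀ ω, |x ω| ≤ 1) {l : ℝ} (hl : |l| ≤ 1 / 2) :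
    ∫ ω, Real.exp (-l * (x ω - ∫ a, x a ∂ν)) ∂ν ≤ Real.exp (l ^ 2 * Var[x; ν]) := by
  have h := integral_quadratic_centered ν (x := x) l 1
  have h2 : ∫ ω, Real.exp (-l * (x ω - ∫ a, x a ∂ν)) ∂ν ≤
      ∫ ω, (1 + -l * (x ω - ∫ a, x a ∂ν) + 1 * (-l * (x ω - ∫ a, x a ∂ν)) ^ 2) ∂ν := by
    refine integral_mono .of_finite .of_finite fun ω => ?_
    have h3 : |-l * (x ω - ∫ a, x a ∂ν)| ≤ 1 := by
      rw [abs_mul, abs_neg]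
      calc _ ≤ 1 / 2 * (2 : ℝ) := by
            gcongr
            exact abs_sub_integral_le_two ν hx ω
        _ = 1 := by norm_num
    simpa using exp_le_one_add_add_sq h3
  have := Real.add_one_le_exp (l ^ 2 * Var[x; ν])
  linarith

lemma exp_le_integral_exp_centered (hx : ∀ ω, |x ω| ≤ 1) {l : ℝ} (hl : |l| ≤ 1 / 10) :
    Real.exp (2 / 5 * (l ^ 2 * Var[x; ν])) ≤ ∫ ω, Real.exp (-l * (x ω - ∫ a, x a ∂ν)) ∂ν := by
  have h := integral_quadratic_centered ν (x := x) l (9 / 20)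
  have h2 : ∫ ω, (1 + -l * (x ω - ∫ a, x a ∂ν) + 9 / 20 * (-l * (x ω - ∫ a, x a ∂ν)) ^ 2) ∂ν ≤
      ∫ ω, Real.exp (-l * (x ω - ∫ a, x a ∂ν)) ∂ν := by
    refine integral_mono .of_finite .of_finite fun ω => ?_
    have h3 : |-l * (x ω - ∫ a, x a ∂ν)| ≤ 1 / 5 := by
      rw [abs_mul, abs_neg]
      calc _ ≤ 1 / 10 * (2 : ℝ) := by
            gcongr
            exact abs_sub_integral_le_two ν hx ω
        _ = 1 / 5 := by norm_num
    exact one_add_add_sq_le_exp h3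
  have hv0 : 0 ≤ Var[x; ν] := variance_nonneg _ _
  have hv4 : Var[x; ν] ≤ 4 := by
    rw [variance_eq_integral (Measurable.of_discrete.aemeasurable)]
    calc _ ≤ ∫ _, (4 : ℝ) ∂ν := by
          refine integral_mono .of_finite .of_finite fun ω => ?_
          have := abs_le.1 (abs_sub_integral_le_two ν hx ω)
          simp only
          nlinarith
      _ = 4 := by simp
  have hl2 : l ^ 2 ≤ 1 / 100 := by
    rw [← sq_abs]; nlinarith [abs_nonneg l]
  have hw0 : 0 ≤ l ^ 2 * Var[x; ν] := by positivity
  have hw : l ^ 2 * Var[x; ν] ≤ 1 / 25 := by nlinarith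
  have h4 := exp_le_one_add_add_sq (x := 2 / 5 * (l ^ 2 * Var[x; ν]))
    (by rw [abs_of_nonneg (by positivity)]; linarith)
  nlinarith

end OneVariable

section Sum

variable {ι Ω : Type*} [Fintype ι] [MeasurableSpace Ω]
  (ν : ι → Measure Ω) [∀ t, IsProbabilityMeasure (ν t)] {x : Ω → ℝ}

lemma integral_exp_sum_eq (x : Ω → ℝ) (l : ℝ) :
    ∫ ω, Real.exp (-l * ∑ t, x (ω t)) ∂(Measure.pi ν) =
      Real.exp (-l * ∑ t, ∫ a, x a ∂(ν t)) *
        ∏ t, ∫ a, Real.exp (-l * (x a - ∫ b, x b ∂(ν t))) ∂(ν t) := by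
  have h : ∀ ω : ι → Ω, Real.exp (-l * ∑ t, x (ω t)) =
      Real.exp (-l * ∑ t, ∫ a, x a ∂(ν t)) *
        ∏ t, Real.exp (-l * (x (ω t) - ∫ b, x b ∂(ν t))) := by
    intro ω
    rw [← Real.exp_sum, ← Real.exp_add, ← Finset.mul_sum, Finset.sum_sub_distrib]
    ring_nf
  simp_rw [h]
  rw [integral_const_mul]
  congr 1
  exact integral_fintype_prod_eq_prod (fun t a => Real.exp (-l * (x a - ∫ b, x b ∂(ν t))))

variable [Finite Ω] [MeasurableSingletonClass Ω]

lemma integral_exp_sum_le (hx : ∀ ω, |x ω| ≤ 1) {l : ℝ} (hl : |l| ≤ 1 / 2) :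
    ∫ ω, Real.exp (-l * ∑ t, x (ω t)) ∂(Measure.pi ν) ≤
      Real.exp (-l * ∑ t, ∫ a, x a ∂(ν t) + l ^ 2 * ∑ t, Var[x; ν t]) := by
  rw [integral_exp_sum_eq, Real.exp_add, Finset.mul_sum Finset.univ _ (l ^ 2), Real.exp_sum]
  refine mul_le_mul_of_nonneg_left ?_ (Real.exp_pos _).le
  exact Finset.prod_le_prod (fun t _ => integral_nonneg fun _ => (Real.exp_pos _).le)
    fun t _ => integral_exp_centered_le (ν t) hx hl

lemma exp_le_integral_exp_sum (hx : ∀ ω, |x ω| ≤ 1) {l : ℝ} (hl : |l| ≤ 1 / 10) :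
    Real.exp (-l * ∑ t, ∫ a, x a ∂(ν t) + 2 / 5 * (l ^ 2 * ∑ t, Var[x; ν t])) ≤
      ∫ ω, Real.exp (-l * ∑ t, x (ω t)) ∂(Measure.pi ν) := by
  rw [integral_exp_sum_eq, Real.exp_add, Finset.mul_sum Finset.univ _ (l ^ 2),
    Finset.mul_sum Finset.univ _ (2 / 5), Real.exp_sum]
  gcongr with t
  exact exp_le_integral_exp_centered (ν t) hx hl

/-- A second moment bound for the exponentially weighted variable: on `{W ≥ 1}` one has
`exp (-l W) ≤ exp (-l / 2) * exp (-(l / 2) W)`, so the mass of `exp (-l W)` that is not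
accounted for by the right-hand side sits on `{W ≤ 0}`, and Cauchy–Schwarz bounds the probability
of that event from below. -/
lemma sq_div_le_measureReal_sum_nonpos (hint : ∀ ω, ∃ k : ℤ, x ω = k) {l a q : ℝ} (hl : 0 ≤ l)
    (ha : 0 ≤ a) (hq : 0 < q)
    (haN : a ≤ ∫ ω, Real.exp (-l * ∑ t, x (ω t)) ∂(Measure.pi ν) -
        Real.exp (-l / 2) * ∫ ω, Real.exp (-(l / 2) * ∑ t, x (ω t)) ∂(Measure.pi ν))
    (hQq : ∫ ω, Real.exp (-(2 * l) * ∑ t, x (ω t)) ∂(Measure.pi ν) ≤ q) :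
    a ^ 2 / q ≤ (Measure.pi ν).real {ω | ∑ t, x (ω t) ≤ 0} := by
  set P := Measure.pi ν
  set N := ∫ ω, Real.exp (-l * ∑ t, x (ω t)) ∂P -
    Real.exp (-l / 2) * ∫ ω, Real.exp (-(l / 2) * ∑ t, x (ω t)) ∂P with hN
  set Q := ∫ ω, Real.exp (-(2 * l) * ∑ t, x (ω t)) ∂P with hQ
  have key : ∀ s : ℝ, 0 ≤ s → 2 * s * N - s ^ 2 * Q ≤ P.real {ω | ∑ t, x (ω t) ≤ 0} := by
    intro s hs
    -- Pointwise, `1_{W ≤ 0} ≥ 2 s (f - g) - s ^ 2 f ^ 2` for `f = exp (-l W)` and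
    -- `g = exp (-l / 2) exp (-(l / 2) W)`.
    have hI : P.real {ω | ∑ t, x (ω t) ≤ 0} =
        ∫ ω, Set.indicator {ω | ∑ t, x (ω t) ≤ 0} (fun _ => (1 : ℝ)) ω ∂P := by
      rw [integral_indicator (Set.toFinite _).measurableSet]; simp
    have hL : 2 * s * N - s ^ 2 * Q = ∫ ω, (2 * s * (Real.exp (-l * ∑ t, x (ω t)) -
        Real.exp (-l / 2) * Real.exp (-(l / 2) * ∑ t, x (ω t))) -
        s ^ 2 * Real.exp (-(2 * l) * ∑ t, x (ω t))) ∂P := by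
      rw [integral_sub .of_finite .of_finite, integral_const_mul, integral_const_mul,
        integral_sub .of_finite .of_finite, integral_const_mul]
    rw [hI, hL]
    refine integral_mono .of_finite .of_finite fun ω => ?_
    have hsq : Real.exp (-(2 * l) * ∑ t, x (ω t)) = Real.exp (-l * ∑ t, x (ω t)) ^ 2 := by
      rw [← Real.exp_nat_mul]; congr 1; push_cast; ring
    have hf := Real.exp_pos (-l * ∑ t, x (ω t))
    have hg := mul_pos (Real.exp_pos (-l / 2)) (Real.exp_pos (-(l / 2) * ∑ t, x (ω t)))
    simp only [hsq]
    by_cases h : ∑ t, x (ω t) ≤ 0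
    · rw [Set.indicator_of_mem (by exact h)]
      nlinarith [sq_nonneg (1 - s * Real.exp (-l * ∑ t, x (ω t))), mul_nonneg hs hg.le]
    · rw [Set.indicator_of_notMem (by exact h)]
      choose k hk using hint
      have h1 : (1 : ℝ) ≤ ∑ t, x (ω t) := by
        have he : ∑ t, x (ω t) = ((∑ t, k (ω t) : ℤ) : ℝ) := by push_cast; simp [hk]
        rw [he] at h ⊢
        norm_cast at h ⊢
        omega
      have hle : Real.exp (-l * ∑ t, x (ω t)) ≤
          Real.exp (-l / 2) * Real.exp (-(l / 2) * ∑ t, x (ω t)) := by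
        rw [← Real.exp_add]
        apply Real.exp_le_exp.2
        nlinarith
      nlinarith [mul_nonneg hs (sub_nonneg.2 hle), sq_nonneg (s * Real.exp (-l * ∑ t, x (ω t)))]
  -- `s = a / q` maximizes the quadratic `2 s a - s ^ 2 q`.
  calc a ^ 2 / q = 2 * (a / q) * a - (a / q) ^ 2 * q := by field_simp; ring
    _ ≤ 2 * (a / q) * N - (a / q) ^ 2 * Q := by gcongr
    _ ≤ _ := key (a / q) (by positivity)

/-- If the mean of a sum `W` of independent integer variables with values in `[-1, 1]` is at most a
small multiple of its variance, and at most `√T` standard deviations, then `W ≤ 0` has a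
probability of at least a constant times `exp (-64 T)`. No lower bound on the variance is needed,
because `W` is an integer. -/
theorem exp_le_measureReal_sum_nonpos (hx : ∀ ω, |x ω| ≤ 1) (hint : ∀ ω, ∃ k : ℤ, x ω = k)
    {T : ℝ} (hT : 1 ≤ T)
    (h1 : ∑ t, ∫ a, x a ∂(ν t) ≤ 3 / 100 * ∑ t, Var[x; ν t])
    (h2 : ∑ t, ∫ a, x a ∂(ν t) ≤ √(T * ∑ t, Var[x; ν t])) :
    (1 - Real.exp (-1 / 20)) ^ 2 * Real.exp (-64 * T) ≤
      (Measure.pi ν).real {ω | ∑ t, x (ω t) ≤ 0} := by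
  set μ := ∑ t, ∫ a, x a ∂(ν t)
  set V := ∑ t, Var[x; ν t] with hV
  have hV0 : 0 ≤ V := Finset.sum_nonneg fun t _ => variance_nonneg _ _
  -- The parameter of order `√(T / V)` that balances mean and variance, cut off at `1 / 10` so that
  -- the quadratic estimates of the exponential moments apply.
  obtain ⟨l, hl0, hl, hlV, hr⟩ : ∃ l : ℝ, 0 ≤ l ∧ l ≤ 1 / 10 ∧ l ^ 2 * V ≤ 16 * T ∧
      -l / 2 + l * μ / 2 - 3 / 20 * (l ^ 2 * V) ≤ -1 / 20 := by
    by_cases hVT : V ≤ 1600 * T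
    · exact ⟨1 / 10, by norm_num, le_rfl, by linarith, by linarith⟩
    · push Not at hVT
      have hVpos : 0 < V := by linarith
      have hsq : √(T / V) ^ 2 = T / V := Real.sq_sqrt (by positivity)
      have hlV : (4 * √(T / V)) ^ 2 * V = 16 * T := by
        rw [mul_pow, hsq]; field_simp; norm_num
      have hle : √(T / V) ≤ 1 / 40 := by
        rw [Real.sqrt_le_left (by norm_num), div_le_iff₀ hVpos]; linarith
      have hmul : √(T / V) * √(T * V) = T := by
        rw [← Real.sqrt_mul (by positivity),
          show T / V * (T * V) = T ^ 2 by field_simp, Real.sqrt_sq (by linarith)]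
      have hμ : √(T / V) * μ ≤ T := by
        calc _ ≤ √(T / V) * √(T * V) := by gcongr
          _ = T := hmul
      exact ⟨4 * √(T / V), by positivity, by linarith, hlV.le, by
        rw [hlV]; linarith [Real.sqrt_nonneg (T / V)]⟩
  have hM := exp_le_integral_exp_sum ν hx (l := l) (by rwa [abs_of_nonneg hl0])
  have hM2 := integral_exp_sum_le ν hx (l := l / 2) (by rw [abs_of_nonneg (by linarith)]; linarith)
  have hQ := integral_exp_sum_le ν hx (l := 2 * l) (by rw [abs_of_nonneg (by linarith)]; linarith)
  have hρ : Real.exp (-1 / 20) ≤ 1 := Real.exp_le_one_iff.2 (by norm_num)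
  have hsub : Real.exp (-l / 2) *
      ∫ ω, Real.exp (-(l / 2) * ∑ t, x (ω t)) ∂(Measure.pi ν) ≤
      Real.exp (-1 / 20) * Real.exp (-l * μ + 2 / 5 * (l ^ 2 * V)) := by
    calc _ ≤ Real.exp (-l / 2) * Real.exp (-(l / 2) * μ + (l / 2) ^ 2 * V) := by gcongr
      _ ≤ _ := by
        rw [← Real.exp_add, ← Real.exp_add]
        apply Real.exp_le_exp.2
        linarith
  refine le_trans ?_ (sq_div_le_measureReal_sum_nonpos ν hint (l := l)
    (a := (1 - Real.exp (-1 / 20)) * Real.exp (-l * μ + 2 / 5 * (l ^ 2 * V))) hl0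
    (mul_nonneg (by linarith) (Real.exp_pos _).le) (Real.exp_pos _) (by linarith) hQ)
  rw [mul_pow, mul_div_assoc, ← Real.exp_nat_mul, ← Real.exp_sub]
  gcongr
  push_cast
  nlinarith

end Sum

/-! ### Separated sequences -/

/-- The square root with the sign of its argument. -/
noncomputable def signedSqrt (x : ℝ) : ℝ := SignType.sign x * √|x|

lemma signedSqrt_sq (x : ℝ) : signedSqrt x ^ 2 = |x| := by
  rcases lt_trichotomy x 0 with h | h | h <;> simp [signedSqrt, h]

/-- The square root turns an increment of order `s √(|x| + |y|)` into one of order `s`. -/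
lemma le_signedSqrt_sub {x y s : ℝ} (hs : 0 ≤ s) (hxy : x < y)
    (h : s * √(|x| + |y|) ≤ y - x) : s / 2 ≤ signedSqrt y - signedSqrt x := by
  have same_sign : ∀ u w : ℝ, 0 ≤ u → u < w → s * √(u ^ 2 + w ^ 2) ≤ w ^ 2 - u ^ 2 →
      s / 2 ≤ w - u := fun u w hu huw h => by
    have hw : w ≤ √(u ^ 2 + w ^ 2) := Real.le_sqrt_of_sq_le (by nlinarith)
    have h1 : s * w ≤ w ^ 2 - u ^ 2 := (mul_le_mul_of_nonneg_left hw hs).trans h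
    have h2 : s / 2 * (w + u) ≤ (w - u) * (w + u) := by nlinarith
    exact le_of_mul_le_mul_right h2 (by linarith)
  have hu := Real.sqrt_nonneg |x|
  have hw := Real.sqrt_nonneg |y|
  have hu2 := Real.sq_sqrt (abs_nonneg x)
  have hw2 := Real.sq_sqrt (abs_nonneg y)
  rcases le_or_gt 0 x with hx | hx
  · have hy : 0 < y := by linarith
    have ex : signedSqrt x = √|x| := by
      rcases hx.eq_or_lt with rfl | hx <;> simp [signedSqrt, *]
    have ey : signedSqrt y = √|y| := by simp [signedSqrt, hy]
    rw [ex, ey]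
    refine same_sign _ _ hu (Real.sqrt_lt_sqrt (abs_nonneg _) ?_) ?_
    · rwa [abs_of_nonneg hx, abs_of_pos hy]
    · rw [hu2, hw2]
      refine h.trans_eq ?_
      rw [abs_of_nonneg hx, abs_of_pos hy]
  · have ex : signedSqrt x = -√|x| := by simp [signedSqrt, hx]
    rcases le_or_gt y 0 with hy | hy
    · have ey : signedSqrt y = -√|y| := by
        rcases hy.eq_or_lt with rfl | hy <;> simp [signedSqrt, *]
      rw [ex, ey]
      have := same_sign _ _ hw (Real.sqrt_lt_sqrt (abs_nonneg y) (x := |y|) (y := |x|) ?_) ?_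
      · linarith
      · rw [abs_of_nonpos hy, abs_of_neg hx]; linarith
      · rw [hu2, hw2, add_comm |y|]
        refine h.trans_eq ?_
        rw [abs_of_nonpos hy, abs_of_neg hx]; ring
    · have ey : signedSqrt y = √|y| := by simp [signedSqrt, hy]
      rw [ex, ey]
      have hpos : 0 < |x| + |y| := by positivity
      have hr2 : √(|x| + |y|) ^ 2 = y - x := by
        rw [Real.sq_sqrt hpos.le, abs_of_neg hx, abs_of_pos hy]; ring
      have hsr : s ≤ √(|x| + |y|) :=
        le_of_mul_le_mul_right (by rw [← sq, hr2]; exact h) (Real.sqrt_pos.2 hpos)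
      have : √(|x| + |y|) ≤ √|x| + √|y| :=
        Real.sqrt_le_iff.2 ⟨by positivity, by nlinarith [mul_nonneg hu hw]⟩
      linarith

lemma sum_sub_two_mul_sq (N : ℝ) (n : ℕ) :
    ∑ i ∈ Finset.range n, (N - 2 * i) ^ 2 =
      n * N ^ 2 - 2 * N * (n * (n - 1)) + 2 / 3 * (n * (n - 1) * (2 * n - 1)) := by
  induction n with
  | zero => simp
  | succ n ih => rw [Finset.sum_range_succ, ih]; push_cast; ring

/-- Reals whose consecutive differences are at least `s` have a sum of squares of order
`s ^ 2 n ^ 3`: pair the entries `i` and `n - 1 - i`, which differ by `|n - 1 - 2 i| s`. -/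
lemma sum_sq_ge_of_separated {s : ℝ} (hs : 0 ≤ s) (n : ℕ) (f : ℕ → ℝ)
    (hf : ∀ i, i + 1 < n → s ≤ f (i + 1) - f i) :
    s ^ 2 * (n * (n ^ 2 - 1)) / 12 ≤ ∑ i ∈ Finset.range n, f i ^ 2 := by
  have hmono : ∀ i k, i + k < n → s * k ≤ f (i + k) - f i := by
    intro i k
    induction k with
    | zero => simp
    | succ k ih =>
      intro h
      have h1 := ih (by omega)
      have h2 := hf (i + k) (by omega)
      push_cast
      rw [← add_assoc]
      linarith
  have hpair : ∀ i ∈ Finset.range n,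
      s ^ 2 / 2 * ((n - 1 : ℝ) - 2 * i) ^ 2 ≤ f i ^ 2 + f (n - 1 - i) ^ 2 := by
    intro i hi
    rw [Finset.mem_range] at hi
    have hsq : ∀ a b c : ℝ, 0 ≤ c → c ≤ b - a → c ^ 2 / 2 ≤ a ^ 2 + b ^ 2 := fun a b c h0 h => by
      nlinarith [sq_nonneg (a + b)]
    rcases le_total i (n - 1 - i) with h | h
    · obtain ⟨k, hk⟩ := Nat.exists_eq_add_of_le h
      have h1 := hsq _ _ _ (by positivity) (hmono i k (by omega))
      have h2 : (n : ℝ) = 2 * i + k + 1 := by norm_cast; omega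
      rw [hk, h2]
      linarith
    · obtain ⟨k, hk⟩ := Nat.exists_eq_add_of_le h
      have h1 := hsq _ _ _ (by positivity) (hmono (n - 1 - i) k (by omega))
      have h2 : (n : ℝ) = 2 * i - k + 1 := by
        have : n + k = 2 * i + 1 := by omega
        have : (n : ℝ) + k = 2 * i + 1 := by exact_mod_cast this
        linarith
      rw [← hk] at h1
      rw [h2]
      linarith
  have hsum := Finset.sum_le_sum hpair
  rw [Finset.sum_add_distrib, Finset.sum_range_reflect (fun i => f i ^ 2) n, ← Finset.mul_sum,
    sum_sub_two_mul_sq] at hsum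
  linarith

/-! ### Vote margins -/

lemma blueFraction_mem_Icc {n : ℕ} {ε : ℝ} (hn : 2 ≤ n) (hε : 0 < ε)
    (hε' : ε ≤ 1 / (11 * ((n : ℝ) - 1))) (i : Fin n) :
    blueFraction n ε i ∈ Set.Icc (5 / 11 : ℝ) (6 / 11) := by
  have hn' : (2 : ℝ) ≤ n := by exact_mod_cast hn
  rw [le_div_iff₀ (by linarith)] at hε'
  have hi : ((i : ℕ) : ℝ) ≤ n - 1 := by
    have : ((i : ℕ) : ℝ) + 1 ≤ n := by exact_mod_cast i.2
    linarith
  have h0 : (0 : ℝ) ≤ (i : ℕ) := by positivity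
  unfold blueFraction
  constructor
  · nlinarith
  · nlinarith

namespace VotingScheme

variable {m n : ℕ} (S : VotingScheme m n)

/-- How much more likely voter `t` is to vote for urn `i` after drawing a blue ball than after
drawing a red one. -/
noncomputable def bias (t : Fin m) (i : Fin n) : ℝ :=
  (S.blue t i).toReal - (S.red t i).toReal

/-- The derivative of the expected number of votes for urn `i` with respect to the fraction of blue
balls. -/
noncomputable def slope (i : Fin n) : ℝ := ∑ t, S.bias t i

/-- The sum of the absolute biases of the voters for urn `i`. It bounds the slope, and the variance
of a lead bounds it. -/
noncomputable def variation (i : Fin n) : ℝ := ∑ t, |S.bias t i|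

/-- The contribution of a vote to the lead of urn `i` over urn `j`. -/
noncomputable def pairLead (i j : Fin n) (a : Fin n) : ℝ :=
  (if a = i then 1 else 0) - (if a = j then 1 else 0)

/-- The probability that voter `t` votes for urn `a`. -/
noncomputable def voteProb (p : ℝ) (t : Fin m) (a : Fin n) : ℝ :=
  p * (S.blue t a).toReal + (1 - p) * (S.red t a).toReal

/-- The expected lead of urn `i` over urn `j`. -/
noncomputable def expectedLead (p : ℝ) (i j : Fin n) : ℝ :=
  ∑ t, (S.voteProb p t i - S.voteProb p t j)

lemma sum_toReal_pmf (q : PMF (Fin n)) : ∑ a, (q a).toReal = 1 := by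
  rw [← ENNReal.toReal_sum fun a _ => q.apply_ne_top a, ← tsum_fintype (L := .unconditional _), q.tsum_coe]
  rfl

lemma sum_variation_le : ∑ i, S.variation i ≤ 2 * m := by
  unfold variation bias
  rw [Finset.sum_comm]
  have h : ∀ t, ∑ i, |(S.blue t i).toReal - (S.red t i).toReal| ≤ 2 := by
    intro t
    calc _ ≤ ∑ i, ((S.blue t i).toReal + (S.red t i).toReal) := by
          refine Finset.sum_le_sum fun i _ => ?_
          have h1 : 0 ≤ (S.blue t i).toReal := ENNReal.toReal_nonneg
          have h2 : 0 ≤ (S.red t i).toReal := ENNReal.toReal_nonneg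
          rw [abs_le]; constructor <;> linarith
      _ = 2 := by
          rw [Finset.sum_add_distrib, sum_toReal_pmf, sum_toReal_pmf]; norm_num
  calc _ ≤ ∑ _ : Fin m, (2 : ℝ) := Finset.sum_le_sum fun t _ => h t
    _ = 2 * m := by simp [mul_comm]

lemma abs_slope_le (i : Fin n) : |S.slope i| ≤ S.variation i := Finset.abs_sum_le_sum_abs _ _

lemma expectedLead_swap (p : ℝ) (i j : Fin n) : S.expectedLead p j i = -S.expectedLead p i j := by
  simp [expectedLead]

lemma expectedLead_sub (p q : ℝ) (i j : Fin n) :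
    S.expectedLead q i j - S.expectedLead p i j = (q - p) * (S.slope i - S.slope j) := by
  unfold expectedLead slope voteProb bias
  rw [← Finset.sum_sub_distrib, ← Finset.sum_sub_distrib, Finset.mul_sum]
  exact Finset.sum_congr rfl fun t _ => by ring

variable {p : ℝ}

lemma isProbabilityMeasure_voteLaw (hp : p ∈ Set.Icc (5 / 11 : ℝ) (6 / 11)) (t : Fin m) :
    IsProbabilityMeasure (S.voteLaw p t) := by
  constructor
  simp only [voteLaw, Measure.add_apply, Measure.smul_apply, measure_univ, smul_eq_mul, mul_one]
  rw [← ENNReal.ofReal_add (by linarith [hp.1]) (by linarith [hp.2])]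
  simp

lemma voteLaw_real_singleton (hp : p ∈ Set.Icc (5 / 11 : ℝ) (6 / 11)) (t : Fin m) (a : Fin n) :
    (S.voteLaw p t).real {a} = S.voteProb p t a := by
  have h1 : 0 ≤ p := by linarith [hp.1]
  have h2 : 0 ≤ 1 - p := by linarith [hp.2]
  rw [Measure.real, voteLaw, Measure.add_apply, Measure.smul_apply, Measure.smul_apply,
    PMF.toMeasure_apply_singleton _ _ (measurableSet_singleton a),
    PMF.toMeasure_apply_singleton _ _ (measurableSet_singleton a), smul_eq_mul, smul_eq_mul,
    ENNReal.toReal_add (ENNReal.mul_ne_top ENNReal.ofReal_ne_top (PMF.apply_ne_top _ _))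
      (ENNReal.mul_ne_top ENNReal.ofReal_ne_top (PMF.apply_ne_top _ _)),
    ENNReal.toReal_mul, ENNReal.toReal_mul, ENNReal.toReal_ofReal h1, ENNReal.toReal_ofReal h2]
  rfl

lemma integral_voteLaw (hp : p ∈ Set.Icc (5 / 11 : ℝ) (6 / 11)) (t : Fin m) (f : Fin n → ℝ) :
    ∫ a, f a ∂(S.voteLaw p t) = ∑ a, S.voteProb p t a * f a := by
  have := S.isProbabilityMeasure_voteLaw hp t
  rw [integral_fintype .of_finite]
  simp only [S.voteLaw_real_singleton hp, smul_eq_mul]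

lemma integral_pairLead (hp : p ∈ Set.Icc (5 / 11 : ℝ) (6 / 11)) (t : Fin m) (i j : Fin n) :
    ∫ a, pairLead i j a ∂(S.voteLaw p t) = S.voteProb p t i - S.voteProb p t j := by
  rw [S.integral_voteLaw hp]
  simp [pairLead, mul_sub, Finset.sum_sub_distrib]

/-- A Bernoulli variable whose parameter mixes `b` and `r` with weights of at least `5 / 11` has a
variance of at least a constant times `|b - r|`, linearly and not just quadratically. -/
lemma mul_one_sub_ge_of_mixture (hp : p ∈ Set.Icc (5 / 11 : ℝ) (6 / 11)) {b r : ℝ}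
    (hb : b ∈ Set.Icc (0 : ℝ) 1) (hr : r ∈ Set.Icc (0 : ℝ) 1) :
    5 / 22 * |b - r| ≤ (p * b + (1 - p) * r) * (1 - (p * b + (1 - p) * r)) := by
  obtain ⟨hp1, hp2⟩ := hp
  obtain ⟨hb1, hb2⟩ := hb
  obtain ⟨hr1, hr2⟩ := hr
  set u := p * b + (1 - p) * r with hu
  have h1 : 5 / 11 * |b - r| ≤ u := by
    rcases abs_cases (b - r) with ⟨h, _⟩ | ⟨h, _⟩ <;> rw [h, hu] <;> nlinarith
  have h2 : 5 / 11 * |b - r| ≤ 1 - u := by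
    rcases abs_cases (b - r) with ⟨h, _⟩ | ⟨h, _⟩ <;> rw [h, hu] <;> nlinarith
  have h0 := abs_nonneg (b - r)
  rcases le_total u (1 / 2) with h | h <;> nlinarith

/-- The variance of a single vote controls its variation between the colours: a certain vote
does not add to the variance, but it does not add to the variation either. -/
lemma le_variance_pairLead (hp : p ∈ Set.Icc (5 / 11 : ℝ) (6 / 11)) (t : Fin m) {i j : Fin n}
    (hij : i ≠ j) :
    5 / 22 * (|S.bias t i| + |S.bias t j|) ≤ Var[pairLead i j; S.voteLaw p t] := by
  have := S.isProbabilityMeasure_voteLaw hp t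
  have hsq : ∫ a, (pairLead i j ^ 2) a ∂(S.voteLaw p t) =
      S.voteProb p t i + S.voteProb p t j := by
    have h : ∀ a, (pairLead i j ^ 2) a =
        (if a = i then (1 : ℝ) else 0) + (if a = j then 1 else 0) := by
      intro a
      simp only [Pi.pow_apply, pairLead]
      split_ifs <;> simp_all
    simp only [h]
    rw [S.integral_voteLaw hp]
    simp [mul_add, Finset.sum_add_distrib]
  rw [variance_eq_sub (MemLp.of_discrete), S.integral_pairLead hp, hsq]
  have mem : ∀ (q : PMF (Fin n)) (a : Fin n), (q a).toReal ∈ Set.Icc (0 : ℝ) 1 := fun q a =>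
    ⟨ENNReal.toReal_nonneg,
      ENNReal.toReal_le_of_le_ofReal zero_le_one (by simpa using q.coe_le_one a)⟩
  have hi := mul_one_sub_ge_of_mixture hp (mem (S.blue t) i) (mem (S.red t) i)
  have hj := mul_one_sub_ge_of_mixture hp (mem (S.blue t) j) (mem (S.red t) j)
  have pos : ∀ a, 0 ≤ S.voteProb p t a := fun a => by
    have h1 := (mem (S.blue t) a).1
    have h2 := (mem (S.red t) a).1
    have h3 : 0 ≤ p := by linarith [hp.1]
    have h4 : 0 ≤ 1 - p := by linarith [hp.2]
    unfold voteProb; positivity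
  have hpos := mul_nonneg (pos i) (pos j)
  unfold bias
  unfold voteProb at *
  nlinarith

lemma le_sum_variance_pairLead (hp : p ∈ Set.Icc (5 / 11 : ℝ) (6 / 11)) {i j : Fin n}
    (hij : i ≠ j) :
    5 / 22 * (S.variation i + S.variation j) ≤ ∑ t, Var[pairLead i j; S.voteLaw p t] := by
  unfold variation
  rw [← Finset.sum_add_distrib, Finset.mul_sum]
  exact Finset.sum_le_sum fun t _ => S.le_variance_pairLead hp t hij

lemma sum_pairLead (v : Fin m → Fin n) (i j : Fin n) :
    ∑ t, pairLead i j (v t) = (voteCount v i : ℝ) - voteCount v j := by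
  simp [pairLead, voteCount, Finset.sum_sub_distrib]

/-- An urn whose expected lead over some other urn is too small compared with the variation of the
two loses with a probability of at least a constant times `exp (-64 T)`. -/
lemma le_failProb_of_expectedLead_le {ε : ℝ} {i j : Fin n} (hij : i ≠ j)
    (hp : blueFraction n ε i ∈ Set.Icc (5 / 11 : ℝ) (6 / 11)) {T : ℝ} (hT : 1 ≤ T)
    (h1 : S.expectedLead (blueFraction n ε i) i j ≤
      3 / 440 * (S.variation i + S.variation j))
    (h2 : S.expectedLead (blueFraction n ε i) i j ≤
      √(T * (5 / 22 * (S.variation i + S.variation j)))) :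
    (1 - Real.exp (-1 / 20)) ^ 2 * Real.exp (-64 * T) ≤ S.failProb ε i := by
  have := S.isProbabilityMeasure_voteLaw hp
  have hV := S.le_sum_variance_pairLead hp hij
  have hmean : ∑ t, ∫ a, pairLead i j a ∂(S.voteLaw (blueFraction n ε i) t) =
      S.expectedLead (blueFraction n ε i) i j :=
    Finset.sum_congr rfl fun t _ => S.integral_pairLead hp t i j
  have hx : ∀ a, |pairLead i j a| ≤ 1 := by
    intro a; unfold pairLead; split_ifs <;> simp
  have hint : ∀ a, ∃ k : ℤ, pairLead i j a = k := fun a =>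
    ⟨(if a = i then 1 else 0) - (if a = j then 1 else 0), by unfold pairLead; push_cast; rfl⟩
  refine (exp_le_measureReal_sum_nonpos (S.voteLaw (blueFraction n ε i)) hx hint hT
    ?_ ?_).trans ?_
  · -- `3 / 100 * (5 / 22) = 3 / 440`
    rw [hmean]; linarith
  · rw [hmean]
    refine h2.trans (Real.sqrt_le_sqrt ?_)
    gcongr
  · unfold failProb ballotLaw
    refine measureReal_mono fun v hv hwin => ?_
    have h := hwin j hij.symm
    rw [Set.mem_ofPred_eq, sum_pairLead, sub_nonpos, Nat.cast_le] at hv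
    omega

/-- If neither of two consecutive urns is likely to lose, then the crossing of their lines of
expected votes between the two blue fractions forces their slopes apart. -/
lemma slope_increment {ε : ℝ} (hε : 0 < ε) (hε' : ε ≤ 3 / 440) {i j : Fin n}
    (hij : (j : ℕ) = i + 1)
    (hpi : blueFraction n ε i ∈ Set.Icc (5 / 11 : ℝ) (6 / 11))
    (hpj : blueFraction n ε j ∈ Set.Icc (5 / 11 : ℝ) (6 / 11)) {T : ℝ} (hT : 1 ≤ T)
    (hi : S.failProb ε i < (1 - Real.exp (-1 / 20)) ^ 2 * Real.exp (-64 * T))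
    (hj : S.failProb ε j < (1 - Real.exp (-1 / 20)) ^ 2 * Real.exp (-64 * T)) :
    S.slope i < S.slope j ∧
      2 * √(T * (5 / 22)) / ε * √(|S.slope i| + |S.slope j|) ≤ S.slope j - S.slope i := by
  have hne : i ≠ j := fun h => by rw [h] at hij; omega
  set D := S.variation i + S.variation j with hD
  have hvar : ∀ k, 0 ≤ S.variation k := fun k => (abs_nonneg _).trans (S.abs_slope_le k)
  have hD0 : 0 ≤ D := add_nonneg (hvar i) (hvar j)
  set a := S.expectedLead (blueFraction n ε i) i j with ha
  set b := S.expectedLead (blueFraction n ε j) j i with hb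
  have hab : a + b = ε * (S.slope j - S.slope i) := by
    have h := S.expectedLead_sub (blueFraction n ε i) (blueFraction n ε j) j i
    have hp : blueFraction n ε j - blueFraction n ε i = ε := by
      simp only [blueFraction, hij]; push_cast; ring
    rw [hp, S.expectedLead_swap (blueFraction n ε i) i j, ← hb, ← ha] at h
    linarith
  -- Slopes are bounded by variations, so neither lead can exceed a small multiple of `D` unless the
  -- other one is negative, in which case that other urn is likely to lose.
  have habD : a + b ≤ 3 / 440 * D := by
    have h1 := (abs_le.1 (S.abs_slope_le i)).1
    have h2 := (abs_le.1 (S.abs_slope_le j)).2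
    rw [hab]
    calc ε * (S.slope j - S.slope i) ≤ ε * D := by gcongr; linarith
      _ ≤ _ := by gcongr
  have hi' : a ≤ 3 / 440 * D → √(T * (5 / 22 * D)) < a := fun h => by
    by_contra! h2
    exact absurd (S.le_failProb_of_expectedLead_le hne hpi hT h h2) (not_le.2 hi)
  have hj' : b ≤ 3 / 440 * D → √(T * (5 / 22 * D)) < b := fun h => by
    by_contra! h2
    rw [hD, add_comm (S.variation i)] at h h2
    exact absurd (S.le_failProb_of_expectedLead_le hne.symm hpj hT h h2) (not_le.2 hj)
  have hr := Real.sqrt_nonneg (T * (5 / 22 * D))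
  have ha0 : 0 < a := by
    by_contra! h
    linarith [hi' (by linarith)]
  have hb0 : 0 < b := by
    by_contra! h
    linarith [hj' (by linarith)]
  have ha1 := hi' (by linarith)
  have hb1 := hj' (by linarith)
  constructor
  · have : 0 < ε * (S.slope j - S.slope i) := by linarith
    linarith [pos_of_mul_pos_right this hε.le]
  · rw [div_mul_eq_mul_div, div_le_iff₀ hε]
    have h1 : √(|S.slope i| + |S.slope j|) ≤ √D :=
      Real.sqrt_le_sqrt (add_le_add (S.abs_slope_le i) (S.abs_slope_le j))
    have h2 : √(T * (5 / 22)) * √D = √(T * (5 / 22 * D)) := by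
      rw [← Real.sqrt_mul (by positivity), mul_assoc]
    have h3 := mul_le_mul_of_nonneg_left h1 (Real.sqrt_nonneg (T * (5 / 22)))
    linarith

/-- A scheme that loses with small probability at every urn has at least about `n ^ 3 T / ε ^ 2`
voters. -/
theorem card_voters_ge {ε : ℝ} (hn : 120 ≤ n) (hε : 0 < ε)
    (hε' : ε ≤ 1 / (11 * ((n : ℝ) - 1))) {T : ℝ} (hT : 1 ≤ T)
    (hS : ∀ i, S.failProb ε i < (1 - Real.exp (-1 / 20)) ^ 2 * Real.exp (-64 * T)) :
    5 / 528 * ((n : ℝ) * (n ^ 2 - 1)) * (ε ^ 2)⁻¹ * T ≤ m := by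
  have hn' : (120 : ℝ) ≤ n := by exact_mod_cast hn
  have hp := fun i => blueFraction_mem_Icc (by omega : 2 ≤ n) hε hε' i
  have hε'' : ε ≤ 3 / 440 := by
    refine hε'.trans ?_
    rw [div_le_div_iff₀ (by linarith) (by norm_num)]
    linarith
  set s := 2 * √(T * (5 / 22)) / ε with hs
  have hs0 : 0 ≤ s := by positivity
  have hs2 : s ^ 2 = 10 / 11 * T * (ε ^ 2)⁻¹ := by
    rw [hs, div_pow, mul_pow, Real.sq_sqrt (by positivity)]; field_simp; norm_num
  -- The signed roots of the slopes, extended by `0` beyond the last urn.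
  let f : ℕ → ℝ := fun k => if h : k < n then signedSqrt (S.slope ⟨k, h⟩) else 0
  have hf : ∀ k, k + 1 < n → s / 2 ≤ f (k + 1) - f k := by
    intro k hk
    obtain ⟨h1, h2⟩ := S.slope_increment hε hε'' (i := ⟨k, by omega⟩) (j := ⟨k + 1, hk⟩) rfl
      (hp _) (hp _) hT (hS _) (hS _)
    have := le_signedSqrt_sub hs0 h1 h2
    simpa only [f, hk, dif_pos, show k < n by omega] using this
  have hsum := sum_sq_ge_of_separated (by positivity) n f hf
  have hle : ∑ k ∈ Finset.range n, f k ^ 2 ≤ 2 * m := by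
    rw [Finset.sum_range]
    refine le_trans (Finset.sum_le_sum fun i _ => ?_) S.sum_variation_le
    simp only [f, i.2, dif_pos, signedSqrt_sq]
    exact S.abs_slope_le i
  rw [div_pow, hs2] at hsum
  linarith

end VotingScheme

theorem mainTheorem2 :
    ∃ H c κ : ℝ, 0 < H ∧ 0 < c ∧ 0 < κ ∧
      ∀ η : ℝ, 0 < η → η < H →
      ∀ (n : ℕ) (ε : ℝ), 120 ≤ n → 0 < ε → ε ≤ 1 / (11 * ((n : ℝ) - 1)) →
      ∀ m : ℕ, (m : ℝ) ≤ c * (n : ℝ) ^ 3 * (ε ^ 2)⁻¹ * Real.log (1 / η) →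
      ∀ S : VotingScheme m n, ∃ i : Fin n, κ * η ≤ S.failProb ε i := by
  have hρ : Real.exp (-1 / 20) < 1 := Real.exp_lt_one_iff.2 (by norm_num)
  refine ⟨Real.exp (-64), 1 / 64 * (1 / 1056), (1 - Real.exp (-1 / 20)) ^ 2, Real.exp_pos _,
    by norm_num, pow_pos (by linarith) 2, ?_⟩
  intro η hη hηH n ε hn hε hε' m hm S
  by_contra! hS
  -- The choice of `T` for which `exp (-64 * T) = η`.
  set T := Real.log (1 / η) / 64 with hTdef
  have hlog : Real.log (1 / η) = -Real.log η := by rw [one_div, Real.log_inv]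
  have hT : 1 ≤ T := by
    have := Real.log_lt_log hη hηH
    rw [Real.log_exp] at this
    linarith
  have hexp : Real.exp (-64 * T) = η := by
    rw [show -64 * T = Real.log η by linarith, Real.exp_log hη]
  have h := S.card_voters_ge hn hε hε' hT (by rwa [hexp])
  have hn' : (120 : ℝ) ≤ n := by exact_mod_cast hn
  have hpos : 0 < (ε ^ 2)⁻¹ * T := by positivity
  have h1 : (n : ℝ) ^ 3 < 5 * (n * (n ^ 2 - 1)) := by nlinarith [sq_nonneg (n : ℝ)]
  have h2 := mul_lt_mul_of_pos_right h1 hpos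
  rw [show Real.log (1 / η) = 64 * T by linarith] at hm
  linarith
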